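/- Let $p,q,r\ge 1$ be integers and let $L$ be the oriented link obtained by closing the $4$-braid $\sigma_1^{p}\sigma_2^{-q}\sigma_3^{r}$ (all strands oriented in parallel). The Alexander polynomial $\Delta_L$ of the closure of a $4$-braid $b$ with exponent sum $e_b$ is $$\Delta_L(t)=\Big(\frac{-1}{\sqrt t}\Big)^{e_b-3}\,\frac{1-t}{1-t^4}\,\det\big(I_3-\psi(b)\big),$$ where $\psi:B_4\to GL(3,\mathbb Z[t,t^{-1}])$ is the reduced Burau representation $$\psi(\sigma_1)=\begin{pmatrix}-t&1&0\\0&1&0\\0&0&1\end{pmatrix},\quad \psi(\sigma_2)=\begin{pmatrix}1&0&0\\t&-t&1\\0&0&1\end{pmatrix},\quad \psi(\sigma_3)=\begin{pmatrix}1&0&0\\0&1&0\\0&t&-t\end{pmatrix}.$$ The signature $\sigma(L)$ is the number of positive minus the number of negative eigenvalues of $M+M^{T}$, where $M$ is the Seifert matrix of the surface that Seifert's algorithm produces from the closed braid diagram. For $n\ge1$ put $[n]=\frac{1-s^n}{1-s}=1+s+\dots+s^{n-1}$, where $s=-t$. A Laurent polynomial $\sum_{k=0}^{n}a_ks^{k+m}$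 with integer coefficients and $a_0,a_n\neq0$ is called *symmetric* if $a_k=a_{n-k}$ for all $k$, and *trapezoidal* if for some $0\le i\le j\le n$ $$a_0<a_1<\dots<a_i=a_{i+1}=\dots=a_j>a_{j+1}>\dots>a_n .$$ The *length of its stable part* is the largest integer $l$ such that $a_k=a_{k+1}=\dots=a_{k+l}$ for some $k$ with $0\le k$ and $k+l\le n$. Then the closed braid diagram of $L$ is alternating and, up to multiplication by a unit of $\mathbb Z[t^{1/2},t^{-1/2}]$, $$\Delta_L=[p]\,[q]\,[r].$$ As a polynomial in $s$, $[p][q][r]$ is symmetric and trapezoidal, all its coefficients from the lowest to the highest are positive, and the length $l$ of its stable part satisfies $l\le|\sigma(L)|$. -/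

import Mathlib

open scoped LaurentPolynomial

/-! ### Braid groups and braid words -/

/-- The relators of Artin's presentation of the braid group on `n` strands. The generator with
index `i : Fin (n - 1)` is the elementary braid `σ_{i+1}`. -/
def braidRels (n : ℕ) : Set (FreeGroup (Fin (n - 1))) :=
  {x | ∃ i j : Fin (n - 1), (i : ℕ) + 2 ≤ (j : ℕ) ∧
      x = FreeGroup.of i * FreeGroup.of j * (FreeGroup.of j * FreeGroup.of i)⁻¹} ∪
  {x | ∃ i j : Fin (n - 1), (i : ℕ) + 1 = (j : ℕ) ∧
      x = FreeGroup.of i * FreeGroup.of j * FreeGroup.of i *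
        (FreeGroup.of j * FreeGroup.of i * FreeGroup.of j)⁻¹}

/-- The braid group `B_n` on `n` strands. -/
abbrev BraidGroup (n : ℕ) : Type := PresentedGroup (braidRels n)

/-- The elementary braid `σ_{i+1}` of `B_n`. -/
def elemBraid {n : ℕ} (i : Fin (n - 1)) : BraidGroup n := PresentedGroup.of i

/-- A braid word on `n` strands, read from the first crossing to the last: the letter `(i, true)` is
the positive crossing `σ_{i+1}` and `(i, false)` is the negative crossing `σ_{i+1}⁻¹`. A braid word
is the same as a braid diagram, and it is used here to denote the oriented link diagram obtained by
closing up that braid diagram, all strands being oriented in parallel. -/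
abbrev BraidWord (n : ℕ) : Type := List (Fin (n - 1) × Bool)

/-- The braid that a braid word represents. -/
def BraidWord.toBraid {n : ℕ} (w : BraidWord n) : BraidGroup n :=
  PresentedGroup.mk (braidRels n) (FreeGroup.mk w)

/-- The word `σ₁ᵖ σ₂⁻ᵠ σ₃ʳ` on four strands. -/
def fourBraidWord (p q r : ℕ) : BraidWord 4 :=
  List.replicate p ((0 : Fin 3), true) ++ List.replicate q ((1 : Fin 3), false) ++
    List.replicate r ((2 : Fin 3), true)

theorem toBraid_append {n : ℕ} (v w : BraidWord n) :
    BraidWord.toBraid (v ++ w) = v.toBraid * w.toBraid := by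
  simp only [BraidWord.toBraid, ← FreeGroup.mul_mk, map_mul]

theorem toBraid_replicate {n : ℕ} (i : Fin (n - 1)) (b : Bool) (m : ℕ) :
    BraidWord.toBraid (List.replicate m (i, b)) =
      elemBraid i ^ (if b then (m : ℤ) else -(m : ℤ)) := by
  induction m with
  | zero => simp [BraidWord.toBraid, ← FreeGroup.one_eq_mk]
  | succ m ih =>
    rw [List.replicate_succ', toBraid_append, ih]
    have h : BraidWord.toBraid [(i, b)] = elemBraid i ^ (if b then (1 : ℤ) else -1) := by
      cases b
      · simp only [BraidWord.toBraid, elemBraid, PresentedGroup.of]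
        simp [← map_inv, FreeGroup.of, FreeGroup.inv_mk, FreeGroup.invRev]
      · simp [BraidWord.toBraid, elemBraid, PresentedGroup.of, FreeGroup.of]
    rw [h, ← zpow_add]
    congr 1
    cases b <;> simp <;> ring

/-- The braid word `fourBraidWord p q r` represents the braid `σ₁ᵖ σ₂⁻ᵠ σ₃ʳ`. -/
theorem toBraid_fourBraidWord (p q r : ℕ) :
    (fourBraidWord p q r).toBraid =
      elemBraid (0 : Fin 3) ^ (p : ℤ) * elemBraid (1 : Fin 3) ^ (-(q : ℤ)) *
        elemBraid (2 : Fin 3) ^ (r : ℤ) := by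
  rw [fourBraidWord, toBraid_append, toBraid_append, toBraid_replicate, toBraid_replicate,
    toBraid_replicate]
  rfl

/-- The exponent sum of a braid, as a homomorphism to the integers. -/
def exponentSum (n : ℕ) : BraidGroup n →* Multiplicative ℤ :=
  PresentedGroup.toGroup (f := fun _ => Multiplicative.ofAdd (1 : ℤ)) (by
    rintro x (⟨i, j, -, rfl⟩ | ⟨i, j, -, rfl⟩) <;> simp)

/-! ### The reduced Burau representation of `B_4` and the Alexander polynomial -/

section Burau

open LaurentPolynomial

theorem T_mul_T_neg (m : ℤ) : (T m * T (-m) : ℤ[T;T⁻¹]) = 1 := by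
  rw [← T_add, add_neg_cancel, T_zero]

theorem T_neg_mul_T (m : ℤ) : (T (-m) * T m : ℤ[T;T⁻¹]) = 1 := by
  rw [← T_add, neg_add_cancel, T_zero]

theorem burauOne_mul_inv {R : Type*} [CommRing R] {t u : R} (h : t * u = 1) :
    (!![-t, 1, 0; 0, 1, 0; 0, 0, 1] * !![-u, u, 0; 0, 1, 0; 0, 0, 1] :
      Matrix (Fin 3) (Fin 3) R) = 1 := by
  ext1 i j
  fin_cases i <;> fin_cases j <;>
    simp [Matrix.mul_apply, Fin.sum_univ_three, h, mul_comm u t]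

theorem burauOne_inv_mul {R : Type*} [CommRing R] {t u : R} (h : t * u = 1) :
    (!![-u, u, 0; 0, 1, 0; 0, 0, 1] * !![-t, 1, 0; 0, 1, 0; 0, 0, 1] :
      Matrix (Fin 3) (Fin 3) R) = 1 := by
  ext1 i j
  fin_cases i <;> fin_cases j <;>
    simp [Matrix.mul_apply, Fin.sum_univ_three, h, mul_comm u t]

/-- The image of `σ₁`, over `ℤ[t, t⁻¹]` with `t = T 1`. -/
noncomputable def burauOne : Matrix.GeneralLinearGroup (Fin 3) ℤ[T;T⁻¹] where
  val := !![-T 1, 1, 0; 0, 1, 0; 0, 0, 1]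
  inv := !![-T (-1), T (-1), 0; 0, 1, 0; 0, 0, 1]
  val_inv := burauOne_mul_inv (T_mul_T_neg 1)
  inv_val := burauOne_inv_mul (T_mul_T_neg 1)

theorem burauTwo_mul_inv {R : Type*} [CommRing R] {t u : R} (h : t * u = 1) :
    (!![1, 0, 0; t, -t, 1; 0, 0, 1] * !![1, 0, 0; 1, -u, u; 0, 0, 1] :
      Matrix (Fin 3) (Fin 3) R) = 1 := by
  ext1 i j
  fin_cases i <;> fin_cases j <;>
    simp [Matrix.mul_apply, Fin.sum_univ_three, h, mul_comm u t]

theorem burauTwo_inv_mul {R : Type*} [CommRing R] {t u : R} (h : t * u = 1) :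
    (!![1, 0, 0; 1, -u, u; 0, 0, 1] * !![1, 0, 0; t, -t, 1; 0, 0, 1] :
      Matrix (Fin 3) (Fin 3) R) = 1 := by
  ext1 i j
  fin_cases i <;> fin_cases j <;>
    simp [Matrix.mul_apply, Fin.sum_univ_three, h, mul_comm u t]

/-- The image of `σ₂`. -/
noncomputable def burauTwo : Matrix.GeneralLinearGroup (Fin 3) ℤ[T;T⁻¹] where
  val := !![1, 0, 0; T 1, -T 1, 1; 0, 0, 1]
  inv := !![1, 0, 0; 1, -T (-1), T (-1); 0, 0, 1]
  val_inv := burauTwo_mul_inv (T_mul_T_neg 1)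
  inv_val := burauTwo_inv_mul (T_mul_T_neg 1)

theorem burauThree_mul_inv {R : Type*} [CommRing R] {t u : R} (h : t * u = 1) :
    (!![1, 0, 0; 0, 1, 0; 0, t, -t] * !![1, 0, 0; 0, 1, 0; 0, 1, -u] :
      Matrix (Fin 3) (Fin 3) R) = 1 := by
  ext1 i j
  fin_cases i <;> fin_cases j <;>
    simp [Matrix.mul_apply, Fin.sum_univ_three, h, mul_comm u t]

theorem burauThree_inv_mul {R : Type*} [CommRing R] {t u : R} (h : t * u = 1) :
    (!![1, 0, 0; 0, 1, 0; 0, 1, -u] * !![1, 0, 0; 0, 1, 0; 0, t, -t] :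
      Matrix (Fin 3) (Fin 3) R) = 1 := by
  ext1 i j
  fin_cases i <;> fin_cases j <;>
    simp [Matrix.mul_apply, Fin.sum_univ_three, h, mul_comm u t]

/-- The image of `σ₃`. -/
noncomputable def burauThree : Matrix.GeneralLinearGroup (Fin 3) ℤ[T;T⁻¹] where
  val := !![1, 0, 0; 0, 1, 0; 0, T 1, -T 1]
  inv := !![1, 0, 0; 0, 1, 0; 0, 1, -T (-1)]
  val_inv := burauThree_mul_inv (T_mul_T_neg 1)
  inv_val := burauThree_inv_mul (T_mul_T_neg 1)

/-- The reduced Burau representation `ψ : B_4 → GL(3, ℤ[t, t⁻¹])`. -/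
noncomputable def burau : BraidGroup 4 →* Matrix.GeneralLinearGroup (Fin 3) ℤ[T;T⁻¹] :=
  PresentedGroup.toGroup (f := ![burauOne, burauTwo, burauThree]) (by
    rintro x (⟨i, j, h, rfl⟩ | ⟨i, j, h, rfl⟩) <;>
      (simp only [map_mul, map_inv, FreeGroup.lift_apply_of, mul_inv_eq_one]
       change Fin 3 at i j
       apply Units.ext
       ext1 a b
       fin_cases i <;> fin_cases j <;> first | (exfalso; simp at h; done) | skip
       all_goals
         fin_cases a <;> fin_cases b <;>
           simp [burauOne, burauTwo, burauThree, Matrix.mul_apply, Fin.sum_univ_three]))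

/-- The ring `ℤ[t^{1/2}, t^{-1/2}]`; here `T 1` stands for `t^{1/2}`, so that `t = T 2`. -/
abbrev HalfLaurent : Type := ℤ[T;T⁻¹]

/-- The inclusion of `ℤ[t, t⁻¹]` into `ℤ[t^{1/2}, t^{-1/2}]`. -/
noncomputable def toHalf : ℤ[T;T⁻¹] →+* HalfLaurent :=
  LaurentPolynomial.eval₂ (Int.castRingHom HalfLaurent)
    (⟨T 2, T (-2), T_mul_T_neg 2, T_neg_mul_T 2⟩ : HalfLaurentˣ)

/-- The ring homomorphism `ℤ[s, s⁻¹] → ℤ[t^{1/2}, t^{-1/2}]` given by the substitution `s = -t`. -/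
noncomputable def substNeg : ℤ[T;T⁻¹] →+* HalfLaurent :=
  LaurentPolynomial.eval₂ (Int.castRingHom HalfLaurent)
    (⟨-T 2, -T (-2), by rw [neg_mul_neg, T_mul_T_neg],
      by rw [neg_mul_neg, T_neg_mul_T]⟩ : HalfLaurentˣ)

/-- The Alexander polynomial of the closure of a `4`-braid `b` with exponent sum `e`,
`(-1 / √t) ^ (e - 3) * ((1 - t) / (1 - t ^ 4)) * det (I - ψ(b))`,
as an element of the field of fractions of `ℤ[t^{1/2}, t^{-1/2}]`. -/
noncomputable def alexanderPolynomial (b : BraidGroup 4) : FractionRing HalfLaurent :=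
  let ι := algebraMap HalfLaurent (FractionRing HalfLaurent)
  (-1 / ι (T 1)) ^ (Multiplicative.toAdd (exponentSum 4 b) - 3) *
    ((1 - ι (T 2)) / (1 - ι (T 2) ^ 4)) *
    ι (toHalf (1 - (burau b : Matrix (Fin 3) (Fin 3) ℤ[T;T⁻¹])).det)

end Burau

/-! ### Alternating closed braid diagrams -/

/-- The crossing `x` involves the strand position `k` (positions are numbered `0, …, n - 1`). -/
def touches {n : ℕ} (x : Fin (n - 1) × Bool) (k : ℕ) : Prop := k = x.1 ∨ k = x.1 + 1

/-- The strand that enters the crossing `x` at position `k` is the overpass there: at a positive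
crossing `σ_{i+1}` the strand that runs from position `i` to position `i + 1` is the overpass, at a
negative crossing it is the other one. -/
def entersOver {n : ℕ} (x : Fin (n - 1) × Bool) (k : ℕ) : Prop := k = x.1 ↔ x.2 = true

/-- The strand that leaves the crossing `x` at position `k` is the overpass there. -/
def leavesOver {n : ℕ} (x : Fin (n - 1) × Bool) (k : ℕ) : Prop := k = x.1 + 1 ↔ x.2 = true

/-- The closure of the braid word `w` is an alternating diagram: whenever a strand leaves a crossing
at position `k` and the next crossing that it meets, going around the closure, is the one `d` steps
later, then it is the overpass at exactly one of these two crossings. -/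
def IsAlternatingClosure {n : ℕ} (w : BraidWord n) : Prop :=
  ∀ (k : ℕ) (x y : Fin (n - 1) × Bool) (j d : ℕ), j < w.length → 0 < d →
    w[j]? = some x → w[(j + d) % w.length]? = some y → touches x k → touches y k →
    (∀ e, 0 < e → e < d → ∀ z, w[(j + e) % w.length]? = some z → ¬ touches z k) →
    (leavesOver x k ↔ ¬ entersOver y k)

/-! ### The Seifert matrix and the signature of a closed braid -/

/-- The sign of a letter of a braid word. -/
def crossingSign {n : ℕ} (x : Fin (n - 1) × Bool) : ℤ := if x.2 then 1 else -1

/-- Seifert's algorithm applied to the closure of a braid word `w` on `n` strands gives `n` parallel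
discs, stacked along an axis, and one half-twisted band for each letter, joining the discs `i` and
`i + 1` when the letter is `σ_{i+1}^{±1}`. A pair of consecutive bands between the same two discs
determines a loop on this surface, which goes up along the disc `i` from the first band to the
second, crosses to the disc `i + 1`, goes down to the first band, and returns. When every generator
occurs in `w` these loops form a basis of the first homology of the surface; in general they form a
basis of the direct sum of the first homology groups of its components. -/
def SeifertLoop {n : ℕ} (w : BraidWord n) : Type :=
  {a : Fin w.length × Fin w.length //
    a.1 < a.2 ∧ (w.get a.1).1 = (w.get a.2).1 ∧
      ∀ l, a.1 < l → l < a.2 → (w.get l).1 ≠ (w.get a.1).1}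

instance {n : ℕ} (w : BraidWord n) : Fintype (SeifertLoop w) := by
  unfold SeifertLoop; infer_instance

instance {n : ℕ} (w : BraidWord n) : DecidableEq (SeifertLoop w) := by
  unfold SeifertLoop; infer_instance

namespace SeifertLoop

variable {n : ℕ} {w : BraidWord n}

/-- The first band of the loop. -/
def fst (a : SeifertLoop w) : Fin w.length := a.1.1

/-- The second band of the loop. -/
def snd (a : SeifertLoop w) : Fin w.length := a.1.2

/-- The lower of the two discs that the loop visits. -/
def col (a : SeifertLoop w) : ℕ := (w.get a.fst).1

end SeifertLoop

/-- The linking number `lk(a, b⁺)` of the loop `a` and the loop `b` pushed off the surface in the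
direction of the discs of higher index. -/
def seifertEntry {n : ℕ} {w : BraidWord n} (a b : SeifertLoop w) : ℤ :=
  if a = b then
    if crossingSign (w.get a.fst) = crossingSign (w.get a.snd) then -crossingSign (w.get a.fst)
    else 0
  else if b.snd = a.fst ∧ crossingSign (w.get a.fst) = 1 then 1
  else if a.snd = b.fst ∧ crossingSign (w.get a.snd) = -1 then -1
  else if a.col = b.col + 1 then
    if b.fst < a.fst ∧ a.fst < b.snd ∧ b.snd < a.snd then -1
    else if a.fst < b.fst ∧ b.fst < a.snd ∧ a.snd < b.snd then 1
    else 0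
  else 0

/-- The Seifert matrix of the closure of a braid word. -/
def seifertMatrix {n : ℕ} (w : BraidWord n) : Matrix (SeifertLoop w) (SeifertLoop w) ℤ :=
  Matrix.of seifertEntry

/-- The signature of a real symmetric matrix: the number of positive eigenvalues minus the number of
negative eigenvalues, counted with multiplicity. -/
noncomputable def matrixSignature {ι : Type*} [Fintype ι] [DecidableEq ι] (S : Matrix ι ι ℝ) : ℤ :=
  (S.charpoly.roots.countP (fun x => 0 < x) : ℤ) - (S.charpoly.roots.countP (fun x => x < 0) : ℤ)

/-- The signature of the closure of a braid word: the signature of `M + Mᵀ` for the Seifert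
matrix `M`. -/
noncomputable def linkSignature {n : ℕ} (w : BraidWord n) : ℤ :=
  matrixSignature ((seifertMatrix w + (seifertMatrix w).transpose).map (Int.cast : ℤ → ℝ))

/-! ### Trapezoidal polynomials -/

section Trapezoidal

open LaurentPolynomial

/-- `f(s) = ∑_{k=0}^{n} a_k s^{k+r}` with nonzero extreme coefficients `a_0` and `a_n`. -/
def IsExpansion (f : ℤ[T;T⁻¹]) (r : ℤ) (n : ℕ) (a : ℕ → ℤ) : Prop :=
  f = ∑ k ∈ Finset.range (n + 1), C (a k) * T ((k : ℤ) + r) ∧ a 0 ≠ 0 ∧ a n ≠ 0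

/-- All coefficients between the lowest and the highest one are positive. -/
def HasPositiveCoeffs (f : ℤ[T;T⁻¹]) : Prop :=
  ∃ r n a, IsExpansion f r n a ∧ ∀ k ≤ n, 0 < a k

/-- `a_k = a_{n-k}` for all `0 ≤ k ≤ n`. -/
def IsSymmetricLaurent (f : ℤ[T;T⁻¹]) : Prop :=
  ∃ r n a, IsExpansion f r n a ∧ ∀ k ≤ n, a k = a (n - k)

/-- `a_0 < a_1 < … < a_i = a_{i+1} = … = a_j > a_{j+1} > … > a_n` for some `0 ≤ i ≤ j ≤ n`. -/
def IsTrapezoidal (f : ℤ[T;T⁻¹]) : Prop :=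
  ∃ r n a, IsExpansion f r n a ∧ ∃ i j, i ≤ j ∧ j ≤ n ∧
    (∀ k, k < i → a k < a (k + 1)) ∧
    (∀ k, i ≤ k → k < j → a k = a (k + 1)) ∧
    (∀ k, j ≤ k → k < n → a (k + 1) < a k)

/-- The length of the stable part of `f` is `l`: the largest `l` such that
`a_k = a_{k+1} = … = a_{k+l}` for some `k`, where `0 ≤ k` and `k + l ≤ n`. -/
def IsStableLength (f : ℤ[T;T⁻¹]) (l : ℕ) : Prop :=
  ∃ r n a, IsExpansion f r n a ∧
    IsGreatest {m : ℕ | ∃ k, k + m ≤ n ∧ ∀ i ≤ m, a (k + i) = a k} l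

/-- `[n] = (1 - s^n) / (1 - s) = 1 + s + … + s^{n-1}`, with `s = T 1`. -/
noncomputable def bracket (n : ℕ) : ℤ[T;T⁻¹] := ∑ i ∈ Finset.range n, T (i : ℤ)

theorem one_sub_mul_bracket (n : ℕ) : (1 - T 1) * bracket n = 1 - T (n : ℤ) := by
  have h : ∀ i : ℕ, (T (i : ℤ) : ℤ[T;T⁻¹]) = T 1 ^ i := fun i => by simp [T_pow]
  simp only [bracket, h]
  exact mul_neg_geom_sum _ _

end Trapezoidal

/-! ### The diagram is alternating -/

/-! Put `s = -t`. Powers of the three Burau generators have geometric sums as entries, so `I - ψ(b)`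
has determinant a unit times `(1 - s + s² - s³) [p] [q] [r]`. The cubic is `1 + t + t² + t³ = (1 -
t⁴) / (1 - t)`, which cancels the normalising fraction (`det_one_sub_burau_product`,
`alexanderPolynomial_fourBraidWord`).

The coefficients of `[a] [b]` form a clipped trapezoid, and a third factor `[c]` takes sliding sums
of width `c`. Consecutive coefficients of the triple product therefore differ by two trapezoid
values at distance `c`. Comparing these for `a ≤ b ≤ c` gives the shape and the stable length `max
(c + 1 - a - b) ε`, with `c + 1 - a - b` truncated at 0 and `ε` the parity of `a + b + c + 1`
(`tripleCoeff_trapezoid`).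

Equal letters are contiguous, so loops in different columns never interleave. The symmetrized
Seifert form is an orthogonal sum of type A Cartan matrices, negative for the `p` and `r` blocks and
positive for the `q` block. Hence `σ(L) = (q - 1) - (p - 1) - (r - 1)`, which has the parity of `p +
q + r + 1`; the bound on the stable length is then elementary. -/

theorem mem_fourBraidWord {p q r : ℕ} {x : Fin 3 × Bool}
    (hx : x ∈ (fourBraidWord p q r : List (Fin 3 × Bool))) :
    x = (0, true) ∨ x = (1, false) ∨ x = (2, true) := by
  simp only [fourBraidWord, List.mem_append, List.mem_replicate] at hx
  tauto

/-- Signs alternate with the column, so over and under depend only on the parity of `k`: strands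
leave over and enter under at odd positions, and the reverse at even ones. -/
theorem isAlternatingClosure_fourBraidWord (p q r : ℕ) :
    IsAlternatingClosure (fourBraidWord p q r) := by
  intro k x y j d _ _ hx hy hxk hyk _
  have hx' := mem_fourBraidWord (List.mem_of_getElem? hx)
  have hy' := mem_fourBraidWord (List.mem_of_getElem? hy)
  rcases hx' with rfl | rfl | rfl <;> rcases hy' with rfl | rfl | rfl <;>
    simp only [touches, leavesOver, entersOver] at * <;> norm_num at * <;> omega

/-! ### Powers of the Burau matrices and the Alexander polynomial -/

section BurauPowers

variable {R : Type*} [CommRing R]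

theorem burauOne_pow (s : R) (n : ℕ) :
    (!![s, 1, 0; 0, 1, 0; 0, 0, 1] : Matrix (Fin 3) (Fin 3) R) ^ n =
      !![s ^ n, ∑ i ∈ Finset.range n, s ^ i, 0; 0, 1, 0; 0, 0, 1] := by
  induction n with
  | zero => ext i j; fin_cases i <;> fin_cases j <;> simp
  | succ n ih =>
    rw [pow_succ, ih, Finset.sum_range_succ, pow_succ]
    ext i j
    fin_cases i <;> fin_cases j <;> simp [Matrix.mul_apply, Fin.sum_univ_three, add_comm]

theorem burauTwo_inv_pow (v : R) (n : ℕ) :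
    (!![1, 0, 0; 1, v, -v; 0, 0, 1] : Matrix (Fin 3) (Fin 3) R) ^ n =
      !![1, 0, 0; ∑ i ∈ Finset.range n, v ^ i, v ^ n, -v * ∑ i ∈ Finset.range n, v ^ i;
        0, 0, 1] := by
  induction n with
  | zero => ext i j; fin_cases i <;> fin_cases j <;> simp
  | succ n ih =>
    rw [pow_succ, ih, Finset.sum_range_succ, pow_succ]
    ext i j
    fin_cases i <;> fin_cases j <;> simp [Matrix.mul_apply, Fin.sum_univ_three]
    ring

theorem burauThree_pow (s : R) (n : ℕ) :
    (!![1, 0, 0; 0, 1, 0; 0, -s, s] : Matrix (Fin 3) (Fin 3) R) ^ n =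
      !![1, 0, 0; 0, 1, 0; 0, -s * ∑ i ∈ Finset.range n, s ^ i, s ^ n] := by
  induction n with
  | zero => ext i j; fin_cases i <;> fin_cases j <;> simp
  | succ n ih =>
    rw [pow_succ, ih, Finset.sum_range_succ, pow_succ]
    ext i j
    fin_cases i <;> fin_cases j <;> simp [Matrix.mul_apply, Fin.sum_univ_three]
    ring

/-- With `s ^ p`, `v ^ q`, `s ^ r` eliminated in favour of the geometric sums, the determinant
becomes a polynomial identity modulo `s * v = 1`, free of exponents. -/
theorem det_one_sub_burau_product {s v P H Q α β γ : R} (hsv : s * v = 1)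
    (hα : α = 1 - (1 - s) * P) (hβ : β = 1 - (1 - v) * H) (hγ : γ = 1 - (1 - s) * Q) :
    (1 - (!![α, P, 0; 0, 1, 0; 0, 0, 1] : Matrix (Fin 3) (Fin 3) R) *
      !![1, 0, 0; H, β, -v * H; 0, 0, 1] * !![1, 0, 0; 0, 1, 0; 0, -s * Q, γ]).det =
      -v * (1 - s + s ^ 2 - s ^ 3) * (P * H * Q) := by
  subst hα hβ hγ
  simp [Matrix.det_fin_three]
  grind

/-- Reverses a geometric sum: the negative crossings produce `[q]` in `s⁻¹`, which is `[q]` in `s`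
up to a unit. -/
theorem pow_mul_geom_sum_inv {s v : R} (hsv : s * v = 1) (n : ℕ) :
    s ^ n * ∑ i ∈ Finset.range (n + 1), v ^ i = ∑ i ∈ Finset.range (n + 1), s ^ i := by
  induction n with
  | zero => simp
  | succ n ih =>
    rw [geom_sum_succ (x := s), ← ih, Finset.sum_range_succ (fun i => v ^ i) (n + 1), mul_add,
      ← mul_pow, hsv, one_pow, pow_succ']
    ring

end BurauPowers

section Alexander

open LaurentPolynomial

theorem burau_elemBraid (i : Fin 3) :
    burau (elemBraid i) = ![burauOne, burauTwo, burauThree] i := by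
  simp [burau, elemBraid]

theorem coe_burau_fourBraidWord (p q r : ℕ) :
    (burau (fourBraidWord p q r).toBraid : Matrix (Fin 3) (Fin 3) ℤ[T;T⁻¹]) =
      (!![-T 1, 1, 0; 0, 1, 0; 0, 0, 1] : Matrix (Fin 3) (Fin 3) ℤ[T;T⁻¹]) ^ p *
        !![1, 0, 0; 1, -T (-1), -(-T (-1)); 0, 0, 1] ^ q *
        !![1, 0, 0; 0, 1, 0; 0, -(-T 1), -T 1] ^ r := by
  rw [toBraid_fourBraidWord, map_mul, map_mul, map_zpow, map_zpow, map_zpow, burau_elemBraid,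
    burau_elemBraid, burau_elemBraid, zpow_natCast, zpow_natCast, zpow_neg, zpow_natCast, ← inv_pow]
  simp only [Units.val_mul, Units.val_pow_eq_pow_val, neg_neg]
  rfl

theorem toHalf_T_one : toHalf (T 1) = T 2 := by
  simp [toHalf, eval₂_T]

theorem toHalf_geom_sum (n : ℕ) :
    toHalf (∑ i ∈ Finset.range n, (-T 1) ^ i) = substNeg (bracket n) := by
  simp [bracket, substNeg, toHalf_T_one]

theorem det_one_sub_burau_fourBraidWord (p q r : ℕ) (hq : 0 < q) :
    ∃ u : HalfLaurentˣ,
      toHalf (1 - (burau (fourBraidWord p q r).toBraid : Matrix (Fin 3) (Fin 3) ℤ[T;T⁻¹])).det =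
        (u : HalfLaurent) * (1 + T 2 + T 2 ^ 2 + T 2 ^ 3) * substNeg (bracket p * bracket q * bracket r) := by
  obtain ⟨m, rfl⟩ : ∃ m, q = m + 1 := ⟨q - 1, by omega⟩
  have hsv : (-T 1 * -T (-1) : ℤ[T;T⁻¹]) = 1 := by rw [neg_mul_neg, T_mul_T_neg]
  have hvs : (-T (-1) * -T 1 : ℤ[T;T⁻¹]) = 1 := by rw [neg_mul_neg, T_neg_mul_T]
  have hH : ∑ i ∈ Finset.range (m + 1), (-T (-1)) ^ i =
      (-T (-1)) ^ m * ∑ i ∈ Finset.range (m + 1), (-T 1 : ℤ[T;T⁻¹]) ^ i := by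
    rw [pow_mul_geom_sum_inv hvs]
  let v : ℤ[T;T⁻¹]ˣ := ⟨-T (-1), -T 1, hvs, hsv⟩
  -- One factor `-v` comes from the determinant formula, and `v ^ m` from reversing the middle sum.
  refine ⟨Units.map toHalf.toMonoidHom (-v ^ (m + 1)), ?_⟩
  rw [coe_burau_fourBraidWord, burauOne_pow, burauTwo_inv_pow, burauThree_pow,
    det_one_sub_burau_product hsv (by rw [mul_neg_geom_sum]; ring)
      (by rw [mul_neg_geom_sum]; ring) (by rw [mul_neg_geom_sum]; ring), hH, map_mul substNeg,
    map_mul substNeg, ← toHalf_geom_sum, ← toHalf_geom_sum, ← toHalf_geom_sum, ← toHalf_T_one]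
  simp only [Units.coe_map, MonoidHom.coe_coe, RingHom.toMonoidHom_eq_coe, Units.val_neg,
    Units.val_pow_eq_pow_val, v, map_pow, map_mul, map_add, map_sub, map_neg, map_one]
  ring

theorem one_sub_T_two_pow_ne_zero : (1 - T 2 ^ 4 : HalfLaurent) ≠ 0 := by
  rw [T_pow, ← T_zero, sub_ne_zero]
  intro h
  have := congrArg LaurentPolynomial.degree h
  rw [degree_T, degree_T] at this
  norm_num at this

theorem alexanderPolynomial_fourBraidWord (p q r : ℕ) (hq : 0 < q) :
    ∃ u : HalfLaurentˣ, alexanderPolynomial (fourBraidWord p q r).toBraid =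
      algebraMap HalfLaurent (FractionRing HalfLaurent)
        (u * substNeg (bracket p * bracket q * bracket r)) := by
  obtain ⟨u, hu⟩ := det_one_sub_burau_fourBraidWord p q r hq
  let ι := algebraMap HalfLaurent (FractionRing HalfLaurent)
  let w : HalfLaurentˣ := ⟨-T (-1), -T 1, by rw [neg_mul_neg, T_neg_mul_T],
    by rw [neg_mul_neg, T_mul_T_neg]⟩
  have hw : -1 / ι (T 1) = ((Units.map ι.toMonoidHom w : (FractionRing HalfLaurent)ˣ) :
      FractionRing HalfLaurent) := by
    have h1 : ι (T 1) * ι (T (-1)) = 1 := by rw [← map_mul, T_mul_T_neg, map_one]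
    have h0 : ι (T 1) ≠ 0 := left_ne_zero_of_mul_eq_one h1
    rw [div_eq_iff h0]
    simp only [Units.coe_map, w, RingHom.toMonoidHom_eq_coe, MonoidHom.coe_coe, map_neg]
    linear_combination h1
  have hd : (1 - ι (T 2) ^ 4) ≠ 0 := by
    rw [← map_pow, ← map_one ι, ← map_sub]
    exact (map_ne_zero_iff ι (IsFractionRing.injective _ _)).2 one_sub_T_two_pow_ne_zero
  refine ⟨w ^ (Multiplicative.toAdd (exponentSum 4 (fourBraidWord p q r).toBraid) - 3) * u, ?_⟩
  rw [alexanderPolynomial]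
  change (-1 / ι (T 1)) ^ _ * _ * ι _ = ι _
  rw [hu, hw, ← Units.val_zpow_eq_zpow_val, ← map_zpow]
  change _ * ((1 - ι (T 2)) / (1 - ι (T 2) ^ 4)) * _ = _
  rw [Units.val_mul, map_mul ι, map_mul ι, map_mul ι, map_mul ι, map_add, map_add, map_add, map_pow,
    map_pow, map_one]
  change ι _ * _ * _ = ι _ * _ * _
  field_simp
  ring

end Alexander

/-! ### The coefficients of a product of three brackets -/

section Coefficients

open LaurentPolynomial Finset

/-- The Laurent polynomial `∑_{k=0}^{n} f(k) s^k`. -/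
noncomputable def genPoly (f : ℤ → ℤ) (n : ℕ) : ℤ[T;T⁻¹] :=
  ∑ k ∈ range (n + 1), C (f k) * T (k : ℤ)

theorem genPoly_add (f g : ℤ → ℤ) (n : ℕ) :
    genPoly (fun k => f k + g k) n = genPoly f n + genPoly g n := by
  simp only [genPoly, map_add, add_mul, sum_add_distrib]

theorem genPoly_extend {f : ℤ → ℤ} {n m : ℕ} (hnm : n ≤ m) (hf : ∀ k : ℤ, n < k → f k = 0) :
    genPoly f m = genPoly f n := by
  symm
  refine sum_subset (range_subset_range.2 (by omega)) fun k _ hk => ?_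
  rw [hf k (by simp only [mem_range] at hk; omega), map_zero, zero_mul]

theorem genPoly_shift {f : ℤ → ℤ} (hf : ∀ k < 0, f k = 0) (n c : ℕ) :
    genPoly (fun k => f (k - c)) (n + c) = genPoly f n * T (c : ℤ) := by
  rw [genPoly, show n + c + 1 = c + (n + 1) by ring, sum_range_add, sum_eq_zero, zero_add, genPoly,
    sum_mul]
  · refine sum_congr rfl fun k _ => ?_
    rw [mul_assoc, ← T_add]
    push_cast
    rw [add_sub_cancel_left, add_comm (c : ℤ)]
  · intro k hk
    rw [hf _ (by simp only [mem_range] at hk; omega), map_zero, zero_mul]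

/-- Each further term of the bracket adds one more shifted copy of `f`. Writing the width as `c + 1`
keeps the degree `n + c` free of truncated subtraction. -/
theorem genPoly_mul_bracket {f : ℤ → ℤ} {n : ℕ} (h0 : ∀ k < 0, f k = 0)
    (hn : ∀ k : ℤ, n < k → f k = 0) (c : ℕ) :
    genPoly f n * bracket (c + 1) = genPoly (fun k => ∑ j ∈ range (c + 1), f (k - j)) (n + c) := by
  induction c with
  | zero => simp [bracket]
  | succ c ih =>
    have hb : bracket (c + 1 + 1) = bracket (c + 1) + T ((c + 1 : ℕ) : ℤ) := by
      rw [bracket, sum_range_succ, ← bracket]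
    rw [hb, mul_add, ih, ← genPoly_shift h0]
    simp only [sum_range_succ _ (c + 1)]
    rw [genPoly_add, ← add_assoc]
    congr 1
    refine (genPoly_extend (by omega) fun k hk => sum_eq_zero fun j hj => hn _ ?_).symm
    simp only [mem_range] at hj
    push_cast at hk
    omega

/-- The coefficient of `s^k` in `[a] [b]`. -/
def pairCoeff (a b : ℕ) (k : ℤ) : ℤ :=
  max 0 (min (min (k + 1) a) (min b (a + b - 1 - k)))

theorem sum_range_ite_eq_pairCoeff (a b : ℕ) (k : ℤ) :
    ∑ j ∈ range b, (if 0 ≤ k - j ∧ k - j < a then (1 : ℤ) else 0) = pairCoeff a b k := by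
  induction b with
  | zero => simp [pairCoeff]
  | succ b ih =>
    rw [sum_range_succ, ih]
    simp only [pairCoeff]
    push_cast
    split_ifs <;> omega

theorem bracket_mul_bracket {a b : ℕ} (ha : 0 < a) (hb : 0 < b) :
    bracket a * bracket b = genPoly (pairCoeff a b) (a + b - 2) := by
  have h : bracket a = genPoly (fun k => if 0 ≤ k ∧ k < a then 1 else 0) (a - 1) := by
    rw [bracket, genPoly, Nat.sub_add_cancel ha]
    refine sum_congr rfl fun k hk => ?_
    simp only [mem_range] at hk
    rw [if_pos (by omega), map_one, one_mul]
  obtain ⟨c, rfl⟩ : ∃ c, b = c + 1 := ⟨b - 1, by omega⟩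
  rw [h, genPoly_mul_bracket (fun k hk => if_neg (by omega)) (fun k hk => if_neg (by omega))]
  simp only [sum_range_ite_eq_pairCoeff]
  congr 1
  omega

/-- The coefficient of `s^k` in `[a] [b] [c]`. -/
def tripleCoeff (a b c : ℕ) (k : ℤ) : ℤ := ∑ j ∈ range c, pairCoeff a b (k - j)

variable {a b c : ℕ}

theorem bracket_mul_bracket_mul_bracket (ha : 0 < a) (hb : 0 < b) (hc : 0 < c) :
    bracket a * bracket b * bracket c = genPoly (tripleCoeff a b c) (a + b + c - 3) := by
  obtain ⟨c, rfl⟩ : ∃ d, c = d + 1 := ⟨c - 1, by omega⟩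
  rw [bracket_mul_bracket ha hb, genPoly_mul_bracket]
  · change genPoly (tripleCoeff a b (c + 1)) _ = _
    congr 1
    omega
  · intro k hk
    simp only [pairCoeff]
    omega
  · intro k hk
    simp only [pairCoeff]
    omega

theorem tripleCoeff_succ_sub (a b c : ℕ) (k : ℤ) :
    tripleCoeff a b c (k + 1) - tripleCoeff a b c k =
      pairCoeff a b (k + 1) - pairCoeff a b (k + 1 - c) := by
  have h := sum_range_sub' (fun j : ℕ => pairCoeff a b (k + 1 - j)) c
  rw [Nat.cast_zero, sub_zero] at h
  rw [← h, sum_sub_distrib, tripleCoeff, tripleCoeff]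
  congr 1
  refine sum_congr rfl fun j _ => ?_
  congr 1
  push_cast
  ring

theorem tripleCoeff_pos (ha : 0 < a) (hb : 0 < b) (hc : 0 < c) {k : ℕ} (hk : k ≤ a + b + c - 3) :
    0 < tripleCoeff a b c k := by
  -- The truncated subtraction gives `j = 0` while `k` lies in the support of `[a] [b]`; beyond it,
  -- `k - j` is the top degree `a + b - 2`.
  refine sum_pos' (fun j _ => le_max_left _ _) ⟨k - (a + b - 2), mem_range.2 (by omega), ?_⟩
  simp only [pairCoeff]
  omega

/-- Reflecting the window, `j ↦ c - 1 - j`, matches the symmetry of `pairCoeff` about `(a + b - 2) /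
2`. -/
theorem tripleCoeff_symm (ha : 0 < a) (hb : 0 < b) (hc : 0 < c) {k : ℕ}
    (hk : k ≤ a + b + c - 3) :
    tripleCoeff a b c k = tripleCoeff a b c (a + b + c - 3 - k : ℕ) := by
  rw [tripleCoeff, tripleCoeff, ← sum_range_reflect]
  refine sum_congr rfl fun j hj => ?_
  simp only [mem_range] at hj
  simp only [pairCoeff]
  omega

theorem isExpansion_bracket (ha : 0 < a) (hb : 0 < b) (hc : 0 < c) :
    IsExpansion (bracket a * bracket b * bracket c) 0 (a + b + c - 3)
      (fun k => tripleCoeff a b c k) := by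
  refine ⟨?_, (tripleCoeff_pos ha hb hc (Nat.zero_le _)).ne', (tripleCoeff_pos ha hb hc le_rfl).ne'⟩
  rw [bracket_mul_bracket_mul_bracket ha hb hc, genPoly]
  simp only [add_zero]

/-! ### Monotonicity and the stable part -/

theorem tripleCoeff_trapezoid (ha : 0 < a) (hab : a ≤ b) (hbc : b ≤ c) :
    ∃ i j, i ≤ j ∧ j ≤ a + b + c - 3 ∧ j - i = max (c + 1 - (a + b)) ((a + b + c + 1) % 2) ∧
      (∀ k : ℕ, k < i → tripleCoeff a b c k < tripleCoeff a b c (k + 1 : ℕ)) ∧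
      (∀ k : ℕ, i ≤ k → k < j → tripleCoeff a b c k = tripleCoeff a b c (k + 1 : ℕ)) ∧
      (∀ k : ℕ, j ≤ k → k < a + b + c - 3 →
        tripleCoeff a b c (k + 1 : ℕ) < tripleCoeff a b c k) := by
  have h := fun k : ℕ => tripleCoeff_succ_sub a b c k
  simp only [pairCoeff] at h
  -- A step from `k` is flat when `k + 1` and `k + 1 - c` both miss the support `0, …, a + b - 2`,
  -- so `a + b - 2 ≤ k ≤ c - 2`, or when they are mirror images in it, so `2 * k = a + b + c - 4`.
  -- As `b ≤ c`, they cannot both lie on the plateau of `[a] [b]`.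
  refine ⟨min (a + b - 2) ((a + b + c - 3) / 2), max (c - 1) ((a + b + c - 2) / 2), by omega,
    by omega, by omega, ?_, ?_, ?_⟩
  · intro k hk
    have := h k
    push_cast
    omega
  · intro k hk hk'
    have := h k
    push_cast
    omega
  · intro k hk hk'
    have := h k
    push_cast
    omega

theorem isGreatest_stable {f : ℕ → ℤ} {n i j : ℕ} (hij : i ≤ j) (hj : j ≤ n)
    (h1 : ∀ k, k < i → f k < f (k + 1)) (h2 : ∀ k, i ≤ k → k < j → f k = f (k + 1))
    (h3 : ∀ k, j ≤ k → k < n → f (k + 1) < f k) :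
    IsGreatest {m : ℕ | ∃ k, k + m ≤ n ∧ ∀ i ≤ m, f (k + i) = f k} (j - i) := by
  constructor
  · refine ⟨i, by omega, fun d => ?_⟩
    induction d with
    | zero => simp
    | succ d ih =>
      intro hd
      rw [← ih (by omega), ← add_assoc, ← h2 (i + d) (by omega) (by omega)]
  · rintro m ⟨k, hk, hm⟩
    rcases Nat.eq_zero_or_pos m with rfl | hm0
    · omega
    have hik : i ≤ k := by
      by_contra hlt
      exact (h1 k (by omega)).ne' (hm 1 hm0)
    have hjk : k + (m - 1) < j := by
      by_contra hlt
      have hlt' := h3 (k + (m - 1)) (by omega) (by omega)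
      rw [hm (m - 1) (by omega), show k + (m - 1) + 1 = k + m by omega, hm m le_rfl] at hlt'
      exact hlt'.false
    omega

theorem hasPositiveCoeffs_bracket (ha : 0 < a) (hb : 0 < b) (hc : 0 < c) :
    HasPositiveCoeffs (bracket a * bracket b * bracket c) :=
  ⟨_, _, _, isExpansion_bracket ha hb hc, fun _ hk => tripleCoeff_pos ha hb hc hk⟩

theorem isSymmetricLaurent_bracket (ha : 0 < a) (hb : 0 < b) (hc : 0 < c) :
    IsSymmetricLaurent (bracket a * bracket b * bracket c) :=
  ⟨_, _, _, isExpansion_bracket ha hb hc, fun _ hk => tripleCoeff_symm ha hb hc hk⟩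

theorem trapezoidal_stableLength_of_le (ha : 0 < a) (hab : a ≤ b) (hbc : b ≤ c) :
    IsTrapezoidal (bracket a * bracket b * bracket c) ∧
      IsStableLength (bracket a * bracket b * bracket c)
        (max (c + 1 - (a + b)) ((a + b + c + 1) % 2)) := by
  obtain ⟨i, j, hij, hj, hl, h1, h2, h3⟩ := tripleCoeff_trapezoid ha hab hbc
  have he := isExpansion_bracket ha (ha.trans_le hab) ((ha.trans_le hab).trans_le hbc)
  refine ⟨⟨_, _, _, he, i, j, hij, hj, h1, h2, h3⟩, _, _, _, he, ?_⟩
  rw [← hl]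
  exact isGreatest_stable (f := fun k : ℕ => tripleCoeff a b c k) hij hj h1 h2 h3

/-- The product ignores the order of its factors, so they may be sorted. If `q` is largest, `c + 1 -
a - b` is the signature itself. If `r` is largest, `r + 1 - p - q ≤ p + r - q - 1` because `p ≥ 1`,
and likewise for `p`. The parity term is covered since an odd integer is nonzero. -/
theorem trapezoidal_stableLength_bracket {p q r : ℕ} (hp : 0 < p) (hq : 0 < q) (hr : 0 < r) :
    IsTrapezoidal (bracket p * bracket q * bracket r) ∧
      ∃ l : ℕ, IsStableLength (bracket p * bracket q * bracket r) l ∧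
        (l : ℤ) ≤ |(q : ℤ) + 1 - p - r| := by
  suffices h : ∃ a b c, 0 < a ∧ a ≤ b ∧ b ≤ c ∧
      bracket p * bracket q * bracket r = bracket a * bracket b * bracket c ∧
      ((max (c + 1 - (a + b)) ((a + b + c + 1) % 2) : ℕ) : ℤ) ≤ |(q : ℤ) + 1 - p - r| by
    obtain ⟨a, b, c, ha, hab, hbc, he, hl⟩ := h
    rw [he]
    exact ⟨(trapezoidal_stableLength_of_le ha hab hbc).1, _,
      (trapezoidal_stableLength_of_le ha hab hbc).2, hl⟩
  rw [abs_eq_max_neg]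
  -- The two cyclic combinations force `p = q = r`.
  rcases le_total p q with h1 | h1 <;> rcases le_total q r with h2 | h2 <;>
    rcases le_total p r with h3 | h3
  · exact ⟨p, q, r, hp, h1, h2, by ring, by omega⟩
  · exact ⟨p, q, r, hp, h1, h2, by ring, by omega⟩
  · exact ⟨p, r, q, hp, h3, h2, by ring, by omega⟩
  · exact ⟨r, p, q, hr, h3, h1, by ring, by omega⟩
  · exact ⟨q, p, r, hq, h1, h3, by ring, by omega⟩
  · exact ⟨q, r, p, hq, h2, h3, by ring, by omega⟩
  · exact ⟨r, q, p, hr, h2, h1, by ring, by omega⟩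
  · exact ⟨r, q, p, hr, h2, h1, by ring, by omega⟩

end Coefficients

/-! ### Signatures of block matrices -/

section Signature

open Matrix

variable {ι : Type*} [Fintype ι] [DecidableEq ι]

theorem card_roots_charpoly_of_posDef {G : Matrix ι ι ℝ} (hG : G.PosDef) :
    G.charpoly.roots.countP (fun x => 0 < x) = Fintype.card ι ∧
      G.charpoly.roots.countP (fun x => x < 0) = 0 := by
  rw [hG.isHermitian.roots_charpoly_eq_eigenvalues]
  constructor
  · rw [Multiset.countP_eq_card.2]
    · simp
    · simp [hG.eigenvalues_pos]
  · rw [Multiset.countP_eq_zero]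
    simp [fun i => (hG.eigenvalues_pos i).le]

theorem card_roots_charpoly_neg_of_posDef {G : Matrix ι ι ℝ} (hG : G.PosDef) :
    (-G).charpoly.roots.countP (fun x => 0 < x) = 0 ∧
      (-G).charpoly.roots.countP (fun x => x < 0) = Fintype.card ι := by
  have hH : (-G).IsHermitian := hG.isHermitian.neg
  have hneg : ∀ i, hH.eigenvalues i < 0 := by
    intro i
    have hv : (hH.eigenvectorBasis i).ofLp ≠ 0 := by
      intro h
      apply hH.eigenvectorBasis.orthonormal.ne_zero i
      ext j
      exact congrFun h j
    have h := hG.dotProduct_mulVec_pos hv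
    rw [hH.eigenvalues_eq]
    simpa [Matrix.neg_mulVec] using h
  rw [hH.roots_charpoly_eq_eigenvalues]
  constructor
  · rw [Multiset.countP_eq_zero]
    simp [fun i => (hneg i).le]
  · rw [Multiset.countP_eq_card.2]
    · simp
    · simp [hneg]

/-- If a matrix is the orthogonal sum of a positive definite and a negative definite part, its
signature is the difference of the sizes of the two parts. -/
theorem matrixSignature_of_posDef {G S : Matrix ι ι ℝ} (hG : G.PosDef) (P : ι → Prop)
    [DecidablePred P] (hpos : ∀ a b, P a → P b → S a b = G a b)
    (hneg : ∀ a b, ¬P a → ¬P b → S a b = -G a b) (hoff : ∀ a b, P a → ¬P b → S a b = 0) :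
    matrixSignature S =
      (Fintype.card {a // P a} : ℤ) - (Fintype.card {a // ¬P a} : ℤ) := by
  let e := (Equiv.sumCompl P).symm
  -- One vanishing off-diagonal block suffices: the characteristic polynomial of a block triangular
  -- matrix is the product over its diagonal blocks.
  have hS : reindex e e S = fromBlocks (G.submatrix ((↑) : {a // P a} → ι) (↑)) 0
      (S.submatrix ((↑) : {a // ¬P a} → ι) ((↑) : {a // P a} → ι))
      (-G.submatrix ((↑) : {a // ¬P a} → ι) (↑)) := by
    ext (a | a) (b | b)
    · simpa [e] using hpos a b a.2 b.2
    · simpa [e] using hoff a b a.2 b.2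
    · simp [e]
    · simpa [e] using hneg a b a.2 b.2
  have hc : S.charpoly.roots = (G.submatrix ((↑) : {a // P a} → ι) (↑)).charpoly.roots +
      (-G.submatrix ((↑) : {a // ¬P a} → ι) (↑)).charpoly.roots := by
    rw [← charpoly_reindex e S, hS, charpoly_fromBlocks_zero₁₂, Polynomial.roots_mul]
    exact mul_ne_zero (charpoly_monic _).ne_zero (charpoly_monic _).ne_zero
  obtain ⟨h1, h2⟩ := card_roots_charpoly_of_posDef
    (hG.submatrix (Subtype.val_injective (p := fun a => P a)))
  obtain ⟨h3, h4⟩ := card_roots_charpoly_neg_of_posDef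
    (hG.submatrix (Subtype.val_injective (p := fun a => ¬P a)))
  rw [matrixSignature, hc, Multiset.countP_add, Multiset.countP_add, h1, h2, h3, h4]
  simp

end Signature

/-! ### The Gram matrix of the Seifert loops -/

section Gram

open Matrix

variable {n : ℕ} {w : BraidWord n}

theorem SeifertLoop.fst_lt_snd (a : SeifertLoop w) : a.fst < a.snd := a.2.1

theorem SeifertLoop.ext_fst_snd {a b : SeifertLoop w} (h1 : a.fst = b.fst) (h2 : a.snd = b.snd) :
    a = b :=
  Subtype.ext (Prod.ext h1 h2)

/-- The boundary map from Seifert loops to bands. -/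
def loopBoundary (w : BraidWord n) : Matrix (Fin w.length) (SeifertLoop w) ℝ :=
  Matrix.of fun l a => (if a.snd = l then 1 else 0) - (if a.fst = l then 1 else 0)

theorem loopBoundary_gram_apply (a b : SeifertLoop w) :
    ((loopBoundary w)ᴴ * loopBoundary w) a b =
      (if b.snd = a.snd then 1 else 0) + (if b.fst = a.fst then 1 else 0) -
        (if b.snd = a.fst then 1 else 0) - (if b.fst = a.snd then 1 else 0) := by
  simp only [mul_apply, conjTranspose_apply, loopBoundary, of_apply, star_trivial, sub_mul,
    Finset.sum_sub_distrib, ite_mul, one_mul, zero_mul, Finset.sum_ite_eq, Finset.mem_univ, if_true]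
  ring

/-- The boundary map is injective: at the first band of `a` only `a` starts, and any loop ending
there starts earlier, so its coefficient vanishes by induction. -/
theorem posDef_loopBoundary_gram (hw : ∀ a b : SeifertLoop w, a.fst = b.fst → a = b) :
    ((loopBoundary w)ᴴ * loopBoundary w).PosDef := by
  refine PosDef.conjTranspose_mul_self _ ?_
  rw [← coe_mulVecLin, injective_iff_map_eq_zero]
  intro x hx
  suffices h : ∀ (m : ℕ) (a : SeifertLoop w), (a.fst : ℕ) = m → x a = 0 from
    funext fun a => h _ a rfl
  intro m
  induction m using Nat.strong_induction_on with
  | _ m ih =>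
    intro a ha
    have h := congrFun hx a.fst
    simp only [mulVecLin_apply, mulVec, dotProduct, loopBoundary, of_apply, Pi.zero_apply,
      sub_mul, Finset.sum_sub_distrib] at h
    rw [Finset.sum_eq_zero, Finset.sum_eq_single a] at h
    · simpa using h
    · intro b _ hb
      rw [if_neg fun h' => hb (hw _ _ h'), zero_mul]
    · simp
    · intro b _
      split_ifs with hb
      · have := b.fst_lt_snd
        rw [hb] at this
        rw [ih _ (by omega) b rfl, mul_zero]
      · rw [zero_mul]

end Gram

/-! ### The signature of the closed four-braid -/

section FourBraid

open Matrix

variable {p q r : ℕ}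

theorem length_fourBraidWord (p q r : ℕ) : (fourBraidWord p q r).length = p + q + r := by
  simp [fourBraidWord, add_assoc]

theorem get_fourBraidWord (l : Fin (fourBraidWord p q r).length) :
    (fourBraidWord p q r).get l =
      if (l : ℕ) < p then (0, true) else if (l : ℕ) < p + q then (1, false) else (2, true) := by
  have h : ∀ (i : ℕ) (hi : i < (List.replicate p ((0 : Fin 3), true) ++
      List.replicate q ((1 : Fin 3), false) ++ List.replicate r ((2 : Fin 3), true)).length),
      (List.replicate p ((0 : Fin 3), true) ++ List.replicate q ((1 : Fin 3), false) ++
        List.replicate r ((2 : Fin 3), true))[i] =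
      if i < p then (0, true) else if i < p + q then (1, false) else (2, true) := by
    intro i hi
    simp only [List.getElem_append, List.length_append, List.length_replicate,
      List.getElem_replicate]
    split_ifs <;> first | rfl | omega
  exact h l l.2

/-- Two bands join the same discs if and only if they lie in the same of the three blocks. -/
theorem get_fst_fourBraidWord_eq_iff (l m : Fin (fourBraidWord p q r).length) :
    ((fourBraidWord p q r).get l).1 = ((fourBraidWord p q r).get m).1 ↔
      ((l : ℕ) < p ↔ (m : ℕ) < p) ∧ ((l : ℕ) < p + q ↔ (m : ℕ) < p + q) := by
  rw [get_fourBraidWord, get_fourBraidWord]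
  split_ifs <;> simp <;> omega

/-- Each generator occupies an interval of the word, so a band strictly between the two would belong
to the same column. -/
theorem snd_eq_fst_add_one (a : SeifertLoop (fourBraidWord p q r)) :
    (a.snd : ℕ) = a.fst + 1 := by
  obtain ⟨⟨i, j⟩, h1, h2, h3⟩ := a
  simp only [SeifertLoop.fst, SeifertLoop.snd] at *
  by_contra hne
  have hij : (i : ℕ) < j := h1
  have hj := j.2
  have h := h3 ⟨i + 1, by omega⟩ (Fin.mk_lt_mk.2 (by simp)) (Fin.mk_lt_mk.2 (by simp; omega))
  rw [get_fst_fourBraidWord_eq_iff] at h2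
  rw [Ne, get_fst_fourBraidWord_eq_iff] at h
  simp only at h h2
  omega

theorem same_block (a : SeifertLoop (fourBraidWord p q r)) :
    ((a.fst : ℕ) < p ↔ (a.fst : ℕ) + 1 < p) ∧ ((a.fst : ℕ) < p + q ↔ (a.fst : ℕ) + 1 < p + q) := by
  have h := (get_fst_fourBraidWord_eq_iff _ _).1 a.2.2.1
  have h' := snd_eq_fst_add_one a
  simp only [SeifertLoop.fst, SeifertLoop.snd] at h' ⊢
  rwa [h'] at h

theorem fst_injective {a b : SeifertLoop (fourBraidWord p q r)} (h : a.fst = b.fst) : a = b := by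
  refine SeifertLoop.ext_fst_snd h (Fin.ext ?_)
  rw [snd_eq_fst_add_one, snd_eq_fst_add_one, h]

/-- The loop lies in the middle column, where the crossings are negative. -/
def IsMiddle (a : SeifertLoop (fourBraidWord p q r)) : Prop :=
  p ≤ (a.fst : ℕ) ∧ (a.fst : ℕ) < p + q

instance : DecidablePred (IsMiddle (p := p) (q := q) (r := r)) := fun _ =>
  inferInstanceAs (Decidable (_ ∧ _))

theorem crossingSign_fst (a : SeifertLoop (fourBraidWord p q r)) :
    crossingSign ((fourBraidWord p q r).get a.fst) = if IsMiddle a then -1 else 1 := by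
  rw [get_fourBraidWord]
  unfold crossingSign IsMiddle
  split_ifs <;> first | rfl | omega | simp_all

theorem crossingSign_snd (a : SeifertLoop (fourBraidWord p q r)) :
    crossingSign ((fourBraidWord p q r).get a.snd) = if IsMiddle a then -1 else 1 := by
  have h := same_block a
  rw [get_fourBraidWord, snd_eq_fst_add_one]
  unfold crossingSign IsMiddle
  split_ifs <;> first | rfl | omega | simp_all

theorem seifertEntry_fourBraidWord (a b : SeifertLoop (fourBraidWord p q r)) :
    seifertEntry a b =
      if a = b then if IsMiddle a then 1 else -1
      else if b.snd = a.fst ∧ ¬IsMiddle a then 1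
      else if a.snd = b.fst ∧ IsMiddle a then -1
      else 0 := by
  have ha := snd_eq_fst_add_one a
  have hb := snd_eq_fst_add_one b
  -- A loop spans two adjacent positions, leaving no room for interleaving.
  have h1 : ¬(b.fst < a.fst ∧ a.fst < b.snd ∧ b.snd < a.snd) := by
    simp only [Fin.lt_def]; omega
  have h2 : ¬(a.fst < b.fst ∧ b.fst < a.snd ∧ a.snd < b.snd) := by
    simp only [Fin.lt_def]; omega
  rw [seifertEntry, crossingSign_fst, crossingSign_snd, if_neg h1, if_neg h2]
  by_cases hm : IsMiddle a <;> simp [hm]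

theorem isMiddle_iff_of_adjacent {a b : SeifertLoop (fourBraidWord p q r)} (h : a.snd = b.fst) :
    IsMiddle a ↔ IsMiddle b := by
  have ha := same_block a
  have hs := snd_eq_fst_add_one a
  rw [h] at hs
  simp only [IsMiddle, hs]
  omega

/-- Both sides have diagonal `±2` and entries `∓1` for loops sharing a band. The sign may be read
off `a` alone because loops sharing a band lie in the same column. -/
theorem symmetrized_seifertEntry (a b : SeifertLoop (fourBraidWord p q r)) :
    ((seifertEntry a b + seifertEntry b a : ℤ) : ℝ) =
      (if IsMiddle a then 1 else -1) *
        ((loopBoundary (fourBraidWord p q r))ᴴ * loopBoundary (fourBraidWord p q r)) a b := by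
  rw [loopBoundary_gram_apply, seifertEntry_fourBraidWord, seifertEntry_fourBraidWord]
  by_cases hab : a = b
  · subst hab
    have h1 := a.fst_lt_snd.ne
    have h2 := a.fst_lt_snd.ne'
    by_cases hm : IsMiddle a <;> simp [hm, h1, h2] <;> norm_num
  · have h1 : ¬b.fst = a.fst := fun h => hab (fst_injective h).symm
    have ha := snd_eq_fst_add_one a
    have hb := snd_eq_fst_add_one b
    have h2 : ¬b.snd = a.snd := fun h => h1 (Fin.ext (by rw [h] at hb; omega))
    by_cases h3 : a.snd = b.fst
    · have h4 : ¬b.snd = a.fst := fun h => by rw [h3] at ha; rw [h] at hb; omega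
      have hm := isMiddle_iff_of_adjacent h3
      by_cases hmb : IsMiddle b <;> simp [hab, Ne.symm hab, h1, h3, h4, hm, hmb, b.fst_lt_snd.ne']
    · by_cases h4 : b.snd = a.fst
      · have hm := isMiddle_iff_of_adjacent h4
        by_cases hma : IsMiddle a <;>
          simp [hab, Ne.symm hab, h1, h3, h4, hm, hma, Ne.symm h3, a.fst_lt_snd.ne]
      · simp [hab, Ne.symm hab, h1, h2, h3, h4, Ne.symm h3]

theorem gram_apply_eq_zero {a b : SeifertLoop (fourBraidWord p q r)} (ha : IsMiddle a)
    (hb : ¬IsMiddle b) :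
    ((loopBoundary (fourBraidWord p q r))ᴴ * loopBoundary (fourBraidWord p q r)) a b = 0 := by
  have h1 : ¬b.fst = a.fst := fun h => hb (fst_injective h ▸ ha)
  have h2 : ¬b.snd = a.snd := fun h => h1 (Fin.ext (by
    have := snd_eq_fst_add_one a
    have := snd_eq_fst_add_one b
    omega))
  have h3 : ¬b.snd = a.fst := fun h => hb ((isMiddle_iff_of_adjacent h).2 ha)
  have h4 : ¬b.fst = a.snd := fun h => hb ((isMiddle_iff_of_adjacent h.symm).1 ha)
  rw [loopBoundary_gram_apply]
  simp [h1, h2, h3, h4]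

/-! ### Counting the loops in each column -/

theorem exists_loop_fst_eq {i : ℕ} (hi : i + 1 < p + q + r) (h1 : i + 1 ≠ p) (h2 : i + 1 ≠ p + q) :
    ∃ a : SeifertLoop (fourBraidWord p q r), (a.fst : ℕ) = i := by
  rw [← length_fourBraidWord] at hi
  refine ⟨⟨(⟨i, by omega⟩, ⟨i + 1, hi⟩), by simp [Fin.lt_def], ?_, ?_⟩, rfl⟩
  · rw [get_fst_fourBraidWord_eq_iff]
    simp only
    omega
  · intro l hl hl'
    simp only [Fin.lt_def] at hl hl'
    omega

/-- A loop is determined by its first band, so counting loops amounts to counting positions. -/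
theorem card_loops (P : SeifertLoop (fourBraidWord p q r) → Prop) [DecidablePred P] (s : Finset ℕ)
    (hs : ∀ i ∈ s, ∃ a, P a ∧ (a.fst : ℕ) = i) (hP : ∀ a, P a → (a.fst : ℕ) ∈ s) :
    Fintype.card {a // P a} = s.card := by
  rw [Fintype.card_subtype]
  refine Finset.card_bij (fun a _ => (a.fst : ℕ)) (fun a ha => hP a (by simpa using ha))
    (fun a _ b _ h => fst_injective (Fin.ext h)) fun i hi => ?_
  obtain ⟨a, ha, rfl⟩ := hs i hi
  exact ⟨a, by simpa using ha, rfl⟩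

theorem card_isMiddle (hq : 0 < q) :
    Fintype.card {a : SeifertLoop (fourBraidWord p q r) // IsMiddle a} = q - 1 := by
  rw [card_loops _ (Finset.Ico p (p + q - 1)), Nat.card_Ico]
  · omega
  · intro i hi
    rw [Finset.mem_Ico] at hi
    obtain ⟨a, rfl⟩ := exists_loop_fst_eq (p := p) (q := q) (r := r) (i := i) (by omega) (by omega)
      (by omega)
    exact ⟨a, ⟨hi.1, by omega⟩, rfl⟩
  · intro a ha
    have := same_block a
    rw [IsMiddle] at ha
    rw [Finset.mem_Ico]
    omega

theorem card_not_isMiddle (hp : 0 < p) (hr : 0 < r) :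
    Fintype.card {a : SeifertLoop (fourBraidWord p q r) // ¬IsMiddle a} = (p - 1) + (r - 1) := by
  rw [card_loops _ (Finset.range (p - 1) ∪ Finset.Ico (p + q) (p + q + r - 1)),
    Finset.card_union_of_disjoint, Finset.card_range, Nat.card_Ico]
  · omega
  · rw [Finset.disjoint_left]
    intro i hi hi'
    simp only [Finset.mem_range, Finset.mem_Ico] at hi hi'
    omega
  · intro i hi
    simp only [Finset.mem_union, Finset.mem_range, Finset.mem_Ico] at hi
    obtain ⟨a, rfl⟩ := exists_loop_fst_eq (p := p) (q := q) (r := r) (i := i) (by omega) (by omega)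
      (by omega)
    exact ⟨a, fun h => by rw [IsMiddle] at h; omega, rfl⟩
  · intro a ha
    have := same_block a
    have h2 := snd_eq_fst_add_one a
    have h3 := a.snd.2
    have h4 := length_fourBraidWord p q r
    rw [IsMiddle] at ha
    simp only [Finset.mem_union, Finset.mem_range, Finset.mem_Ico]
    omega

theorem linkSignature_fourBraidWord (hp : 0 < p) (hq : 0 < q) (hr : 0 < r) :
    linkSignature (fourBraidWord p q r) = (q : ℤ) + 1 - p - r := by
  have hS : ∀ a b, ((seifertMatrix (fourBraidWord p q r) +
      (seifertMatrix (fourBraidWord p q r))ᵀ).map (Int.cast : ℤ → ℝ)) a b = _ :=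
    fun a b => symmetrized_seifertEntry a b
  rw [linkSignature, matrixSignature_of_posDef
    (posDef_loopBoundary_gram fun a b h => fst_injective h) IsMiddle, card_isMiddle hq,
    card_not_isMiddle hp hr]
  · omega
  · intro a b ha _
    rw [hS, if_pos ha, one_mul]
  · intro a b ha _
    rw [hS, if_neg ha, neg_one_mul]
  · intro a b ha hb
    rw [hS, gram_apply_eq_zero ha hb, mul_zero]

end FourBraid

theorem mainTheorem2 (p q r : ℕ) (hp : 0 < p) (hq : 0 < q) (hr : 0 < r) :
    -- the closure `L` of the braid word `σ₁ᵖ σ₂⁻ᵠ σ₃ʳ` is an alternating diagram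
    IsAlternatingClosure (fourBraidWord p q r) ∧
    -- up to a unit of `ℤ[t^{1/2}, t^{-1/2}]`, its Alexander polynomial is `[p] [q] [r]` at `s = -t`
    (∃ u : HalfLaurentˣ, alexanderPolynomial (fourBraidWord p q r).toBraid =
      algebraMap HalfLaurent (FractionRing HalfLaurent)
        (u * substNeg (bracket p * bracket q * bracket r))) ∧
    -- this polynomial in `s` is trapezoidal, with stable part of length at most `|σ(L)|`
    HasPositiveCoeffs (bracket p * bracket q * bracket r) ∧
    IsSymmetricLaurent (bracket p * bracket q * bracket r) ∧
    IsTrapezoidal (bracket p * bracket q * bracket r) ∧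
    ∃ l : ℕ, IsStableLength (bracket p * bracket q * bracket r) l ∧
      (l : ℤ) ≤ |linkSignature (fourBraidWord p q r)| := by
  obtain ⟨ht, l, hl, hle⟩ := trapezoidal_stableLength_bracket hp hq hr
  refine ⟨isAlternatingClosure_fourBraidWord p q r, alexanderPolynomial_fourBraidWord p q r hq,
    hasPositiveCoeffs_bracket hp hq hr, isSymmetricLaurent_bracket hp hq hr, ht, l, hl, ?_⟩
  rwa [linkSignature_fourBraidWord hp hq hr]
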